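/- **Smooth 3-split of the biadjoint amplitude.** Let $K$ be a field of characteristic zero and let $P^2:=Q(P)$ for a quadratic form $Q$ on a $K$-vector space $V$ (for instance $\mathbb{R}^{1,D-1}$ with the Minkowski form, or a space over a field of rational functions, so that the Mandelstam invariants below are formal variables). Let $p_1,\dots,p_n\in V$ satisfy $p_a^2=0$ for all $a$ and $p_1+\cdots+p_n=0$. Put $s_{ab}=(p_a+p_b)^2$ and, for cyclically consecutive labels modulo $n$, $s_{a,a+1,\dots,b}=(p_a+p_{a+1}+\cdots+p_b)^2$. For vectors $q_1,\dots,q_m\in V$ with $m\ge 3$ and $q_1+\cdots+q_m=0$ put $$F(q_1,\dots,q_m)=\sum_{T}\ \prod_{e}\frac{1}{P_e^2},\qquad P_e=\sum_{a\in L_e}q_a ,$$ where $T$ runs over all planar unrooted binary (cubic) trees with leaves $1,\dots,m$ in this planar order, $e$ runs over the internal edges of $T$, and $L_e$ is either of the two sets of leaves separated by $e$. The partial biadjoint amplitude is $m_n(\mathbb{I},\mathbb{I})=F(p_1,\dots,p_n)$. The amputated Berends–Giele current, with one off-shell leg of momentum $-(p_a+\cdots+p_b)$, is $$\mathcal{J}(a,a+1,\dots,b)=F\bigl(p_a,p_{a+1},\dots,p_b,\,-(p_a+p_{a+1}+\cdots+p_b)\bigr),$$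 with labels modulo $n$; in particular $\mathcal{J}(a,a+1)=1$. Let $1\le i<j<k\le n$. The $(i,j,k)$ split kinematics is the condition that $s_{ab}=0$ for every pair $(a,b)$ that interlaces the triple, i.e. such that, up to cyclic rotation of the labels, $a<i<b<j<k$ or $a<j<b<k<i$ or $a<k<b<i<j$. (If $i,j,k$ are three cyclically consecutive labels, this imposes no condition.) Then, at every point of the $(i,j,k)$ split kinematics at which $m_n(\mathbb{I},\mathbb{I})$ is defined, i.e. at which no planar invariant $s_{a,a+1,\dots,a+l-1}$ with $2\le l\le n-2$ vanishes, $$m_n(\mathbb{I},\mathbb{I})=\mathcal{J}(i,i+1,\dots,j)\ \mathcal{J}(j,j+1,\dots,k)\ \mathcal{J}(k,k+1,\dots,i).$$ Moreover the split kinematics is not contained in the polar locus of $m_n(\mathbb{I},\mathbb{I})$: for every $K$, $n$ and $i<j<k$ as above there are a quadratic form on some $K^D$ and vectors $p_1,\dots,p_n\in K^D$ that satisfy all these conditions. -/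

import Mathlib

open Finset

/-!
Tree-level kinematics over a field `K` (of characteristic zero in the theorem).  Momenta are vectors of a `K`-module `V` with a quadratic
form `Q`, and `P² = Q P`.  For `V = ℝ^{1,D-1}` with the Minkowski form these are ordinary real
momenta; for the quotient of `Kⁿ` by `(1, …, 1)` with the form `∑_{a<b} s_{ab} x_a x_b` they are
given by arbitrary (formal) Mandelstam invariants `s_{ab}` with vanishing row sums.
Particle labels are `0, …, n - 1`, that is, elements of `Fin n`, whose addition is modulo `n`.
-/

namespace Biadjoint

/-! ### Planar binary trees

A planar unrooted binary (cubic) tree whose leaves are labelled `0, …, m - 1` in the planar order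
is described by planting it at its last leaf `m - 1`.  What grows from there is a rooted plane
binary tree whose `m - 1` leaves are, from left to right, `0, …, m - 2`, and which has `m - 2`
nodes (the cubic vertices).  Its internal edges are the edges from a node to another node; the edge
that joins the root node to the leaf `m - 1` is external.  The pair `(lo, hi)` stands for an
internal edge that separates the leaves `lo ≤ a < hi` from the other ones. -/

/-- The internal edges in the branch `T` whose leftmost leaf is `lo` and which is itself attached
to a node: the edge of attachment, if `T` is not a single leaf, and the edges inside `T`. -/
def branchEdges : BinaryTree Unit → ℕ → Multiset (ℕ × ℕ)
  | .nil, _ => 0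
  | .node u l r, lo =>
      (lo, lo + (BinaryTree.node u l r).numLeaves) ::ₘ
        (branchEdges l lo + branchEdges r (lo + l.numLeaves))

/-- The internal edges of the planar unrooted binary tree described by the planted tree `T`. -/
def internalEdges : BinaryTree Unit → Multiset (ℕ × ℕ)
  | .nil => 0
  | .node _ l r => branchEdges l 0 + branchEdges r l.numLeaves

/-- The set `𝒯` of all planar unrooted binary trees with `m ≥ 3` leaves. -/
def planarTrees (m : ℕ) : Finset (BinaryTree Unit) :=
  BinaryTree.treesOfNumNodesEq (m - 2)

section Kinematics

variable {K V : Type*} [Field K] [AddCommGroup V] [Module K V]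

/-- `P_e`: the total momentum on the side `L_e` of the edge `e` of a tree with legs `q`. -/
def edgeMomentum {m : ℕ} (q : Fin m → V) (e : ℕ × ℕ) : V :=
  ∑ a : Fin m with e.1 ≤ a.val ∧ a.val < e.2, q a

/-- The fully amputated sum of planar cubic Feynman diagrams with the external legs
`q 0, …, q (m - 1)` in this planar order: `∑_{T ∈ 𝒯} ∏_{e ∈ E(T)} 1 / P_e²`, where `e` runs over
the internal edges.  The legs need not be on-shell. -/
def diagramSum (Q : QuadraticForm K V) {m : ℕ} (q : Fin m → V) : K :=
  ∑ T ∈ planarTrees m, ((internalEdges T).map fun e => (Q (edgeMomentum q e))⁻¹).prod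

variable {n : ℕ}

/-- Massless momenta that obey momentum conservation: `p_a² = 0` and `p_1 + ⋯ + p_n = 0`. -/
structure IsMassless (Q : QuadraticForm K V) (p : Fin n → V) : Prop where
  onShell : ∀ a, Q (p a) = 0
  conservation : ∑ a, p a = 0

/-- The Mandelstam invariant `s_{ab} = (p_a + p_b)²`. -/
def mandelstam (Q : QuadraticForm K V) (p : Fin n → V) (a b : Fin n) : K :=
  Q (p a + p b)

/-- The partial biadjoint amplitude `m_n(𝕀, 𝕀)` as a function of the momenta. -/
def biadjointAmplitude (Q : QuadraticForm K V) (p : Fin n → V) : K :=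
  diagramSum Q p

/-- `p_a + p_{a+1} + ⋯ + p_{a+l-1}`, with labels modulo `n`. -/
def arcMomentum [NeZero n] (p : Fin n → V) (a : Fin n) (l : ℕ) : V :=
  ∑ t ∈ range l, p (a + Fin.ofNat n t)

/-- No planar pole `s_{a,a+1,…,a+l-1}` with `2 ≤ l ≤ n - 2` (labels modulo `n`) vanishes. -/
def IsPlanarNonsingular [NeZero n] (Q : QuadraticForm K V) (p : Fin n → V) : Prop :=
  ∀ (a : Fin n) (l : ℕ), 2 ≤ l → l + 2 ≤ n → Q (arcMomentum p a l) ≠ 0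

/-- The number of labels in the cyclic interval `a, a+1, …, b`. -/
def arcLength (a b : Fin n) : ℕ := (b - a).val + 1

/-- The amputated Berends–Giele current `𝒥(a, a+1, …, b)`, with labels modulo `n`: the planar legs
are the on-shell ones `p_a, …, p_b`, followed by one off-shell leg with momentum
`-(p_a + ⋯ + p_b)`; no external leg carries a propagator. -/
def amputatedCurrent [NeZero n] (Q : QuadraticForm K V) (p : Fin n → V) (a b : Fin n) : K :=
  diagramSum Q
    (Fin.snoc (α := fun _ => V) (fun t : Fin (arcLength a b) => p (a + Fin.ofNat n t.val))
      (-arcMomentum p a (arcLength a b)) : Fin (arcLength a b + 1) → V)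

/-- The pair `(a, b)` interlaces the triple `(i, j, k)`: in the cyclic order of the labels
`a < i < b < j < k`, or `a < j < b < k < i`, or `a < k < b < i < j`.  Here `Set.cIoo x y` is the
open cyclic interval from `x` to `y`, and `i < j < k` is understood. -/
def Interlaces (a b i j k : Fin n) : Prop :=
  (a ∈ Set.cIoo k i ∧ b ∈ Set.cIoo i j) ∨
  (a ∈ Set.cIoo i j ∧ b ∈ Set.cIoo j k) ∨
  (a ∈ Set.cIoo j k ∧ b ∈ Set.cIoo k i)

/-- The `(i, j, k)` split kinematics: `s_{ab} = 0` whenever `(a, b)` interlaces `(i, j, k)`. -/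
def IsSplitKinematics (Q : QuadraticForm K V) (p : Fin n → V) (i j k : Fin n) : Prop :=
  ∀ a b, Interlaces a b i j k → mandelstam Q p a b = 0

end Kinematics

end Biadjoint

/-! An internal edge is recorded as the arc `x, …, y - 1` of legs on one side, with pole variable `X
x y`, so that diagram sums become Berends–Giele recursions in `X`. In every tree the paths to `i`,
`j`, `k` meet at one vertex, whose three branches carry arcs cut at some `x` in `(i, j]`, `z` in
`(j, k]` and `y` in `(k, i + n]`. Hence the amplitude is a sum over the cuts of products of three
currents (`IsCyclicPoles.amputated_eq_sum`).

Each of these arcs contains exactly one of the three legs, say `j`. Let `A` and `B` be the momenta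
on its two sides. On split kinematics `A` and `B` are orthogonal and `p_j` is null, so `(A + p_j +
B)² = (A + p_j)² + (p_j + B)²` (`poles_add`). This additivity makes the current a product of one
factor ending at `j` and one starting at `j` (`current_eq_mul`). The six resulting factors regroup
by cut: the two that involve `x` sum to the current of `i, …, j`, and likewise for `z` and `y`.

For non-emptiness, basis vectors and minus their sum are used, with a form that pairs only
neighbours, up to one correction term. -/

namespace Biadjoint

/-! ### Berends–Giele recursion and factorization of currents -/

section Currents

variable {K : Type*} [Field K]

/-- The product of the inverse pole variables `X lo hi` over a collection of edges. -/
def propagators (X : ℕ → ℕ → K) (E : Multiset (ℕ × ℕ)) : K :=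
  (E.map fun e => (X e.1 e.2)⁻¹).prod

lemma propagators_add (X : ℕ → ℕ → K) (E F : Multiset (ℕ × ℕ)) :
    propagators X (E + F) = propagators X E * propagators X F := by
  simp [propagators]

/-- The Berends–Giele current of the legs `x, …, y - 1`, with the propagator `1 / X x y` of the
root (absent for a single leg). -/
def current (X : ℕ → ℕ → K) (x y : ℕ) : K :=
  ∑ T ∈ BinaryTree.treesOfNumNodesEq (y - x - 1), propagators X (branchEdges T x)

/-- The Berends–Giele current of the legs `x, …, y - 1` without the propagator of the root. -/
def amputated (X : ℕ → ℕ → K) (x y : ℕ) : K :=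
  ∑ z ∈ Ioo x y, current X x z * current X z y

lemma sum_treesOfNumNodesEq_succ {M : Type*} [AddCommMonoid M] (m : ℕ)
    (f : BinaryTree Unit → M) :
    ∑ T ∈ BinaryTree.treesOfNumNodesEq (m + 1), f T =
      ∑ ab ∈ antidiagonal m, ∑ l ∈ BinaryTree.treesOfNumNodesEq ab.1,
        ∑ r ∈ BinaryTree.treesOfNumNodesEq ab.2, f (.node () l r) := by
  rw [BinaryTree.treesOfNumNodesEq_succ, sum_biUnion]
  · refine sum_congr rfl fun ab _ => ?_
    rw [sum_map, sum_product]
    rfl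
  · intro a _ b _ hab
    simp only [Function.onFun, disjoint_left, mem_map, mem_product,
      BinaryTree.mem_treesOfNumNodesEq, Prod.exists]
    rintro _ ⟨l, r, ⟨h1, h2⟩, rfl⟩ ⟨l', r', ⟨h3, h4⟩, h⟩
    obtain ⟨rfl, rfl⟩ : l' = l ∧ r' = r := by simpa using h
    exact hab (Prod.ext (h1.symm.trans h3) (h2.symm.trans h4))

lemma sum_Ioo_eq_sum_antidiagonal {M : Type*} [AddCommMonoid M] (x m : ℕ) (f : ℕ → M) :
    ∑ z ∈ Ioo x (x + m + 2), f z = ∑ ab ∈ antidiagonal m, f (x + ab.1 + 1) := by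
  rw [Nat.sum_antidiagonal_eq_sum_range_succ_mk, sum_range, ← sum_range (fun a => f (x + a + 1))]
  have : Ioo x (x + m + 2) = Ico (x + 1) (x + 1 + m.succ) := by ext; simp; omega
  rw [this, sum_Ico_eq_sum_range]
  simp [add_right_comm]

/-- The root splits the legs at `z = x + l.numLeaves`. The value at `.nil` is a dummy, since every
tree in the sum has a node. -/
lemma sum_propagators_node (X : ℕ → ℕ → K) (x m : ℕ) :
    ∑ T ∈ BinaryTree.treesOfNumNodesEq (m + 1),
      (match T with
        | .nil => 0
        | .node _ l r => propagators X (branchEdges l x + branchEdges r (x + l.numLeaves))) =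
      amputated X x (x + m + 2) := by
  rw [sum_treesOfNumNodesEq_succ, amputated, sum_Ioo_eq_sum_antidiagonal]
  refine sum_congr rfl fun ab hab => ?_
  rw [HasAntidiagonal.mem_antidiagonal] at hab
  rw [current, current, sum_mul_sum, show x + ab.1 + 1 - x - 1 = ab.1 by omega,
    show x + m + 2 - (x + ab.1 + 1) - 1 = ab.2 by omega]
  refine sum_congr rfl fun l hl => sum_congr rfl fun r _ => ?_
  rw [BinaryTree.mem_treesOfNumNodesEq] at hl
  simp only [propagators_add, BinaryTree.numLeaves_eq_numNodes_succ, hl, add_assoc]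

lemma current_succ (X : ℕ → ℕ → K) (x : ℕ) : current X x (x + 1) = 1 := by
  simp [current, propagators, branchEdges]

lemma current_eq (X : ℕ → ℕ → K) {x y : ℕ} (h : x + 2 ≤ y) :
    current X x y = (X x y)⁻¹ * amputated X x y := by
  obtain ⟨m, rfl⟩ : ∃ m, y = x + m + 2 := ⟨y - x - 2, by omega⟩
  rw [← sum_propagators_node, mul_sum, current, show x + m + 2 - x - 1 = m + 1 by omega]
  refine sum_congr rfl fun T hT => ?_
  rw [BinaryTree.mem_treesOfNumNodesEq] at hT
  cases T with
  | nil => simp at hT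
  | node u l r =>
    simp only [branchEdges, BinaryTree.numLeaves_eq_numNodes_succ, hT]
    simp [propagators, add_assoc]

lemma amputated_eq (X : ℕ → ℕ → K) {x y : ℕ} (h : x + 2 ≤ y) (hX : X x y ≠ 0) :
    amputated X x y = X x y * current X x y := by
  rw [current_eq X h, mul_inv_cancel_left₀ hX]

lemma amputated_succ (X : ℕ → ℕ → K) (x : ℕ) : amputated X x (x + 1) = 0 := by
  exact sum_eq_zero fun z hz => absurd (mem_Ioo.1 hz) (by omega)

/-- Currents only depend on the pole variables of the subintervals. -/
lemma current_congr {X Y : ℕ → ℕ → K} {c x y : ℕ} (hxy : x < y)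
    (h : ∀ z w, x ≤ z → z < w → w ≤ y → X z w = Y (c + z) (c + w)) :
    current X x y = current Y (c + x) (c + y) := by
  induction hm : y - x using Nat.strong_induction_on generalizing x y with
  | _ m ih =>
    obtain rfl | h2 := Nat.eq_or_lt_of_le (Nat.succ_le_of_lt hxy)
    · rw [current_succ, Nat.succ_eq_add_one, ← add_assoc, current_succ]
    · rw [current_eq X (by omega), current_eq Y (by omega), h x y le_rfl hxy le_rfl, amputated,
        amputated]
      congr 1
      refine sum_bij' (fun z _ => c + z) (fun z _ => z - c) ?_ ?_ ?_ ?_ ?_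
      · intro z hz; simp at hz ⊢; omega
      · intro z hz; simp at hz ⊢; omega
      · intro z hz; simp
      · intro z hz; simp at hz ⊢; omega
      · intro z hz
        rw [mem_Ioo] at hz
        rw [ih (z - x) (by omega) hz.1 (fun a b h1 h2 h3 => h a b h1 h2 (by omega)) rfl,
          ih (y - z) (by omega) hz.2 (fun a b h1 h2 h3 => h a b (by omega) h2 h3) rfl]

/-- The root carries no propagator, so agreement on proper subintervals suffices. -/
lemma amputated_congr {X Y : ℕ → ℕ → K} {c x y : ℕ}
    (h : ∀ z w, x ≤ z → z < w → w ≤ y → w < z + (y - x) → X z w = Y (c + z) (c + w)) :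
    amputated X x y = amputated Y (c + x) (c + y) := by
  refine sum_bij' (fun z _ => c + z) (fun z _ => z - c) ?_ ?_ ?_ ?_ ?_
  · intro z hz; simp at hz ⊢; omega
  · intro z hz; simp at hz ⊢; omega
  · intro z hz; simp
  · intro z hz; simp at hz ⊢; omega
  · intro z hz
    rw [mem_Ioo] at hz
    rw [current_congr hz.1 (fun a b h1 h2 h3 => h a b h1 h2 (by omega) (by omega)),
      current_congr hz.2 (fun a b h1 h2 h3 => h a b (by omega) h2 h3 (by omega))]

/-- If the pole variables of the arcs through `j` are additive, then the currents factorize. -/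
lemma current_eq_mul {X : ℕ → ℕ → K} {i j k : ℕ}
    (hX : ∀ x z, i < x → x ≤ j → j < z → z ≤ k → x + 2 ≤ z → X x z ≠ 0)
    (hadd : ∀ x z, i < x → x < j → j + 1 < z → z ≤ k → X x z = X x (j + 1) + X j z)
    {x z : ℕ} (hix : i < x) (hxj : x ≤ j) (hjz : j < z) (hzk : z ≤ k) :
    current X x z = current X x (j + 1) * current X j z := by
  induction hm : z - x using Nat.strong_induction_on generalizing x z with
  | _ m ih =>
    obtain rfl | hxj' := Nat.eq_or_lt_of_le hxj
    · rw [current_succ, one_mul]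
    obtain rfl | hjz' := Nat.eq_or_lt_of_le (Nat.succ_le_of_lt hjz)
    · rw [Nat.succ_eq_add_one, current_succ, mul_one]
    -- The root cut falls on one side of leg `j`. The piece that still contains `j` factorizes by
    -- induction, and the other piece completes a recursion on its own side.
    have hsplit : amputated X x z =
        amputated X x (j + 1) * current X j z + current X x (j + 1) * amputated X j z := by
      have : Ioo x z = Ioo x (j + 1) ∪ Ioo j z := by ext; simp; omega
      have hd : Disjoint (Ioo x (j + 1)) (Ioo j z) := by
        rw [disjoint_left]; intro a; simp; omega
      rw [amputated, this, sum_union hd, amputated, amputated, sum_mul, mul_sum]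
      congr 1
      · refine sum_congr rfl fun w hw => ?_
        rw [mem_Ioo] at hw
        rw [ih (z - w) (by omega) (by omega) (by omega) hjz hzk rfl, mul_assoc]
      · refine sum_congr rfl fun w hw => ?_
        rw [mem_Ioo] at hw
        rw [ih (w - x) (by omega) hix hxj (by omega) (by omega) rfl, mul_assoc]
    rw [amputated_eq X (by omega) (hX x z hix hxj hjz hzk (by omega)),
      amputated_eq X (by omega) (hX x (j + 1) hix hxj (by omega) (by omega) (by omega)),
      amputated_eq X (by omega) (hX j z (by omega) le_rfl hjz hzk (by omega))] at hsplit
    have h0 := hX x z hix hxj hjz hzk (by omega)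
    apply mul_left_cancel₀ h0
    rw [hsplit, hadd x z hix hxj' hjz' hzk]
    ring

end Currents

/-! ### Cyclic invariance and the decomposition at the meeting vertex -/

section Cyclic

variable {K : Type*} [Field K]

/-- Pole variables `X x y` of the arcs `x, …, y - 1` of a cycle of `n` legs: complementary arcs
share their pole variable, and no planar pole vanishes. -/
structure IsCyclicPoles (X : ℕ → ℕ → K) (n : ℕ) : Prop where
  add_add : ∀ x y, X (x + n) (y + n) = X x y
  compl : ∀ x y, x < y → y < x + n → X y (x + n) = X x y
  ne_zero : ∀ x y, x + 2 ≤ y → y + 2 ≤ x + n → X x y ≠ 0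

variable {X : ℕ → ℕ → K} {n : ℕ}

lemma IsCyclicPoles.current_add_add (hX : IsCyclicPoles X n) {x y : ℕ} (h : x < y) :
    current X (x + n) (y + n) = current X x y := by
  rw [add_comm x, add_comm y]
  refine (current_congr h fun z w _ _ _ => ?_).symm
  rw [add_comm n, add_comm n, hX.add_add]

/-- The sum over planar trees does not depend on whether it is planted at the leg `r + n - 1` or
at the next leg. -/
lemma IsCyclicPoles.amputated_rotate (hX : IsCyclicPoles X n) (hn : 3 ≤ n) (r : ℕ) :
    amputated X r (r + n - 1) = amputated X (r + 1) (r + n) := by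
  -- Both sides cut the full interval into three consecutive pieces, at `z < w`.
  have h1 : ∑ w ∈ Ioo r (r + n), amputated X r w * current X w (r + n) =
      ∑ z ∈ Ioo r (r + n), current X r z * amputated X z (r + n) := by
    simp_rw [amputated, sum_mul, mul_sum]
    rw [sum_comm' (t' := Ioo r (r + n)) (s' := fun z => Ioo z (r + n))]
    · exact sum_congr rfl fun z _ => sum_congr rfl fun w _ => mul_assoc _ _ _
    · intro z w; simp only [mem_Ioo]; omega
  have hI : Ioo r (r + n) = insert (r + 1) (insert (r + n - 1) (Ioo (r + 1) (r + n - 1))) := by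
    ext; simp; omega
  -- An arc and its complement share a pole, so the amputation can be moved across the edge. Only
  -- the two extreme cuts survive in `h1`.
  have h2 : ∑ w ∈ Ioo (r + 1) (r + n - 1), amputated X r w * current X w (r + n) =
      ∑ w ∈ Ioo (r + 1) (r + n - 1), current X r w * amputated X w (r + n) := by
    refine sum_congr rfl fun w hw => ?_
    rw [mem_Ioo] at hw
    have h0 := hX.ne_zero r w (by omega) (by omega)
    have hc := hX.compl r w (by omega) (by omega)
    rw [amputated_eq X (by omega) h0, amputated_eq X (by omega) (hc ▸ h0), hc]
    ring
  have e1 : r + n = r + n - 1 + 1 := by omega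
  rw [hI, sum_insert (by simp; omega), sum_insert (by simp), sum_insert (by simp; omega),
    sum_insert (by simp), h2] at h1
  have e2 : current X (r + n - 1) (r + n) = 1 := by
    conv_lhs => rw [e1, Nat.add_sub_cancel]
    exact current_succ _ _
  have e3 : amputated X (r + n - 1) (r + n) = 0 := by
    conv_lhs => rw [e1, Nat.add_sub_cancel]
    exact amputated_succ _ _
  rw [e2, e3, amputated_succ, current_succ] at h1
  linear_combination h1

lemma IsCyclicPoles.amputated_zero (hX : IsCyclicPoles X n) (hn : 3 ≤ n) (r : ℕ) :
    amputated X 0 (n - 1) = amputated X r (r + n - 1) := by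
  induction r with
  | zero => rw [zero_add]
  | succ r ih => rw [ih, hX.amputated_rotate hn, show r + 1 + n - 1 = r + n by omega]

/-- The sum over planar trees, organized by the vertex at which the paths to the legs `i`, `j`
and `k` meet. -/
lemma IsCyclicPoles.amputated_eq_sum (hX : IsCyclicPoles X n) {i j k : ℕ} (hij : i < j)
    (hjk : j < k) (hki : k < i + n) :
    amputated X (i + 1) (i + n) =
      ∑ x ∈ Ioc i j, ∑ y ∈ Ioc k (i + n), ∑ z ∈ Ioc j k,
        current X x z * current X z y * current X y (x + n) := by
  -- The edges `(x, y)` separate `i` from `j` and `k`. `E1` opens the vertex at the end towards `j`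
  -- and `k`, `E2` the one towards `i`. The two agree edge by edge except on the external leg `i`,
  -- which has no vertex at its outer end; there the difference is the whole amplitude.
  set E1 := ∑ x ∈ Ioc i j, ∑ y ∈ Ioc k (i + n), amputated X x y * current X y (x + n) with hE1
  set E2 := ∑ x ∈ Ioc i j, ∑ y ∈ Ioc k (i + n), current X x y * amputated X y (x + n) with hE2
  have hdiff : E1 - E2 = amputated X (i + 1) (i + n) := by
    rw [hE1, hE2, ← sum_sub_distrib, sum_eq_single (i + 1), ← sum_sub_distrib,
      sum_eq_single (i + n)]
    · rw [add_right_comm i 1 n, current_succ, amputated_succ]; ring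
    · intro y hy hne
      rw [mem_Ioc] at hy
      have h0 := hX.ne_zero (i + 1) y (by omega) (by omega)
      have hc := hX.compl (i + 1) y (by omega) (by omega)
      rw [amputated_eq X (by omega) h0, amputated_eq X (by omega) (hc ▸ h0), hc]
      ring
    · simp; omega
    · intro x hx hne
      rw [← sum_sub_distrib]
      refine sum_eq_zero fun y hy => ?_
      rw [mem_Ioc] at hx hy
      have h0 := hX.ne_zero x y (by omega) (by omega)
      have hc := hX.compl x y (by omega) (by omega)
      rw [amputated_eq X (by omega) h0, amputated_eq X (by omega) (hc ▸ h0), hc]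
      ring
    · simp; omega
  -- In `L` and `R` the vertex keeps `j` and `k` together, with a side branch between `i` and `j` or
  -- between `k` and `i`; in `C` it separates all three. Vertices of the first kind have an edge on
  -- either side along the path, so they occur in both `E1` and `E2`, and only `C` survives.
  set L := ∑ x ∈ Ioc i j, ∑ y ∈ Ioc k (i + n), ∑ z ∈ Ioc x j,
    current X x z * current X z y * current X y (x + n) with hL
  set R := ∑ x ∈ Ioc i j, ∑ y ∈ Ioc k (i + n), ∑ z ∈ Ioo k y,
    current X x z * current X z y * current X y (x + n) with hR
  set C := ∑ x ∈ Ioc i j, ∑ y ∈ Ioc k (i + n), ∑ z ∈ Ioc j k,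
    current X x z * current X z y * current X y (x + n) with hC
  have h1 : E1 = L + C + R := by
    rw [hE1, hL, hR, hC, ← sum_add_distrib, ← sum_add_distrib]
    refine sum_congr rfl fun x hx => ?_
    rw [← sum_add_distrib, ← sum_add_distrib]
    refine sum_congr rfl fun y hy => ?_
    rw [mem_Ioc] at hx hy
    have hI : Ioo x y = (Ioc x j ∪ Ioc j k) ∪ Ioo k y := by ext; simp; omega
    rw [amputated, sum_mul, hI, sum_union, sum_union]
    · rw [disjoint_left]; intro a; simp; omega
    · rw [disjoint_left]; intro a; simp; omega
  have h2 : E2 = L + R := by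
    have hs : E2 = ∑ x ∈ Ioc i j, ∑ y ∈ Ioc k (i + n), ∑ w ∈ Ioo i x,
          current X w x * current X x y * current X y (w + n) +
        ∑ x ∈ Ioc i j, ∑ y ∈ Ioc k (i + n), ∑ z ∈ Ioc y (i + n),
          current X x y * current X y z * current X z (x + n) := by
      rw [hE2, ← sum_add_distrib]
      refine sum_congr rfl fun x hx => ?_
      rw [← sum_add_distrib]
      refine sum_congr rfl fun y hy => ?_
      rw [mem_Ioc] at hx hy
      -- A cut beyond leg `i + n` is written `w + n`, which puts the side branch `w, …, x - 1`
      -- between `i` and `j`.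
      have hI : Ioo y (x + n) = Ioc y (i + n) ∪ (Ioo i x).map (addRightEmbedding n) := by
        rw [map_add_right_Ioo]; ext; simp; omega
      rw [amputated, mul_sum, hI, sum_union, sum_map, add_comm]
      · congr 1
        · refine sum_congr rfl fun w hw => ?_
          rw [mem_Ioo] at hw
          rw [addRightEmbedding_apply, hX.current_add_add hw.2]
          ring
        · exact sum_congr rfl fun w hw => (mul_assoc _ _ _).symm
      · rw [map_add_right_Ioo, disjoint_left]; intro a; simp; omega
    rw [hs, hL, hR]
    congr 1
    · rw [sum_comm, sum_comm (s := Ioc i j)]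
      refine sum_congr rfl fun y _ => sum_comm' ?_
      intro a b; simp only [mem_Ioc, mem_Ioo]; omega
    · refine sum_congr rfl fun x _ => sum_comm' ?_
      intro a b; simp only [mem_Ioc, mem_Ioo]; omega
  linear_combination h1 - h2 - hdiff

/-- If the pole variables of all arcs through exactly one of the legs `i`, `j`, `k` are additive,
then the sum over planar trees factorizes. -/
lemma IsCyclicPoles.amputated_split (hX : IsCyclicPoles X n) {i j k : ℕ} (hij : i < j)
    (hjk : j < k) (hki : k < i + n)
    (hi : ∀ x z, k < x → x < i + n → i + n + 1 < z → z ≤ j + n →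
      X x z = X x (i + n + 1) + X (i + n) z)
    (hj : ∀ x z, i < x → x < j → j + 1 < z → z ≤ k → X x z = X x (j + 1) + X j z)
    (hk : ∀ x z, j < x → x < k → k + 1 < z → z ≤ i + n → X x z = X x (k + 1) + X k z) :
    amputated X 0 (n - 1) =
      amputated X i (j + 1) * amputated X j (k + 1) * amputated X k (i + n + 1) := by
  have e1 : i + 1 + n - 1 = i + n := by omega
  rw [hX.amputated_zero (by omega) (i + 1), e1, hX.amputated_eq_sum hij hjk hki]
  have hj' : ∀ x ∈ Ioc i j, ∀ z ∈ Ioc j k,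
      current X x z = current X x (j + 1) * current X j z := by
    intro x hx z hz
    rw [mem_Ioc] at hx hz
    exact current_eq_mul (fun x z _ _ _ _ h => hX.ne_zero x z h (by omega)) hj hx.1 hx.2 hz.1 hz.2
  have hk' : ∀ z ∈ Ioc j k, ∀ y ∈ Ioc k (i + n),
      current X z y = current X z (k + 1) * current X k y := by
    intro z hz y hy
    rw [mem_Ioc] at hz hy
    exact current_eq_mul (fun x z _ _ _ _ h => hX.ne_zero x z h (by omega)) hk hz.1 hz.2 hy.1 hy.2
  have hi' : ∀ y ∈ Ioc k (i + n), ∀ x ∈ Ioc i j,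
      current X y (x + n) = current X y (i + n + 1) * current X i x := by
    intro y hy x hx
    rw [mem_Ioc] at hy hx
    rw [← hX.current_add_add hx.1]
    exact current_eq_mul (fun x z _ _ _ _ h => hX.ne_zero x z h (by omega)) hi hy.1 hy.2
      (by omega) (by omega)
  have a1 : Ioo i (j + 1) = Ioc i j := by ext; simp only [mem_Ioo, mem_Ioc]; omega
  have a2 : Ioo j (k + 1) = Ioc j k := by ext; simp only [mem_Ioo, mem_Ioc]; omega
  have a3 : Ioo k (i + n + 1) = Ioc k (i + n) := by ext; simp only [mem_Ioo, mem_Ioc]; omega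
  -- The three currents on the right are the sums over the cuts `x`, `z` and `y` respectively; their
  -- product is matched termwise.
  rw [amputated, amputated, amputated, a1, a2, a3, mul_assoc, mul_comm (∑ z ∈ Ioc j k, _),
    sum_mul_sum, sum_mul_sum]
  refine sum_congr rfl fun x hx => ?_
  refine sum_congr rfl fun y hy => ?_
  rw [mul_sum]
  refine sum_congr rfl fun z hz => ?_
  rw [hj' x hx z hz, hk' z hz y hy, hi' y hy x hx]
  ring

end Cyclic

/-! ### From momenta to pole variables -/

section Momenta

variable {K V : Type*} [Field K] [AddCommGroup V] [Module K V]

lemma edgeMomentum_eq_sum_Ico {m : ℕ} {q : Fin m → V} {f : ℕ → V} {z w : ℕ} (hw : w ≤ m)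
    (h : ∀ a : Fin m, a.val < w → q a = f a.val) :
    edgeMomentum q (z, w) = ∑ t ∈ Ico z w, f t := by
  refine sum_nbij (fun a => a.val) ?_ Fin.val_injective.injOn ?_ ?_
  · intro a ha; simpa using ha
  · intro t ht
    rw [coe_Ico, Set.mem_Ico] at ht
    exact ⟨⟨t, by omega⟩, by simpa using ht, rfl⟩
  · intro a ha
    rw [mem_filter] at ha
    exact h a ha.2.2

lemma diagramSum_eq_amputated (Q : QuadraticForm K V) {m : ℕ} (hm : 3 ≤ m) (q : Fin m → V) :
    diagramSum Q q = amputated (fun x y => Q (edgeMomentum q (x, y))) 0 (m - 1) := by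
  obtain ⟨m, rfl⟩ := Nat.exists_eq_add_of_le' hm
  have := sum_propagators_node (fun x y => Q (edgeMomentum q (x, y))) 0 m
  rw [show m + 3 - 1 = 0 + m + 2 by omega, ← this, diagramSum, planarTrees,
    show m + 3 - 2 = m + 1 by omega]
  refine sum_congr rfl fun T hT => ?_
  rw [BinaryTree.mem_treesOfNumNodesEq] at hT
  cases T with
  | nil => simp at hT
  | node u l r => simp [internalEdges, propagators]

/-- The planar pole variable of the legs `x, …, y - 1`, with labels modulo `n`. -/
def poles {n : ℕ} [NeZero n] (Q : QuadraticForm K V) (p : Fin n → V) (x y : ℕ) : K :=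
  Q (∑ t ∈ Ico x y, p (Fin.ofNat n t))

variable {n : ℕ} [NeZero n] {Q : QuadraticForm K V} {p : Fin n → V}

lemma ofNat_val_add (a : Fin n) (t : ℕ) : a + Fin.ofNat n t = Fin.ofNat n (a.val + t) := by
  ext; simp [Fin.val_add]

lemma ofNat_add_self (t : ℕ) : Fin.ofNat n (t + n) = Fin.ofNat n t := by
  ext; simp

lemma arcMomentum_eq_sum_Ico (p : Fin n → V) (a : Fin n) (l : ℕ) :
    arcMomentum p a l = ∑ t ∈ Ico a.val (a.val + l), p (Fin.ofNat n t) := by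
  rw [arcMomentum, sum_Ico_eq_sum_range, Nat.add_sub_cancel_left]
  simp only [ofNat_val_add]

lemma sum_Ico_ofNat_shift (p : Fin n → V) (x y : ℕ) :
    ∑ t ∈ Ico (x + n) (y + n), p (Fin.ofNat n t) = ∑ t ∈ Ico x y, p (Fin.ofNat n t) := by
  rw [← sum_Ico_add']
  simp only [ofNat_add_self]

lemma sum_Ico_ofNat_period (p : Fin n → V) (x : ℕ) :
    ∑ t ∈ Ico x (x + n), p (Fin.ofNat n t) = ∑ a, p a := by
  induction x with
  | zero =>
    rw [zero_add, ← range_eq_Ico, sum_range]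
    simp
  | succ x ih =>
    rw [← ih, sum_eq_sum_Ico_succ_bot (a := x) (by have := NeZero.pos n; omega),
      show x + 1 + n = x + n + 1 by omega, sum_Ico_succ_top (by have := NeZero.pos n; omega),
      ofNat_add_self, add_comm]

lemma poles_add_add (Q : QuadraticForm K V) (p : Fin n → V) (x y : ℕ) :
    poles Q p (x + n) (y + n) = poles Q p x y := by
  rw [poles, sum_Ico_ofNat_shift, poles]

lemma poles_compl (Q : QuadraticForm K V) (hp : ∑ a, p a = 0) {x y : ℕ} (h1 : x ≤ y)
    (h2 : y ≤ x + n) : poles Q p y (x + n) = poles Q p x y := by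
  have := sum_Ico_consecutive (fun t => p (Fin.ofNat n t)) h1 h2
  rw [sum_Ico_ofNat_period, hp] at this
  rw [poles, poles, eq_neg_of_add_eq_zero_right this, QuadraticMap.map_neg]

lemma isCyclicPoles (hp : ∑ a, p a = 0) (hs : IsPlanarNonsingular Q p) :
    IsCyclicPoles (poles Q p) n where
  add_add := poles_add_add Q p
  compl x y h1 h2 := poles_compl Q hp h1.le h2.le
  ne_zero x y h1 h2 := by
    have h := hs (Fin.ofNat n x) (y - x) (by omega) (by omega)
    rw [arcMomentum] at h
    rw [poles, sum_Ico_eq_sum_range]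
    convert h using 5
    ext; simp [Fin.val_add]

/-- For null momenta `s_{ab}` is the polar pairing, so the momenta on the two sides of `j` are
orthogonal by bilinearity. -/
lemma poles_add (hp : ∀ a, Q (p a) = 0) {x j z : ℕ} (hx : x ≤ j) (hz : j + 1 ≤ z)
    (h : ∀ a b, x ≤ a → a < j → j < b → b < z →
      mandelstam Q p (Fin.ofNat n a) (Fin.ofNat n b) = 0) :
    poles Q p x z = poles Q p x (j + 1) + poles Q p j z := by
  have hpolar : QuadraticMap.polar Q (∑ b ∈ Ico (j + 1) z, p (Fin.ofNat n b))
      (∑ a ∈ Ico x j, p (Fin.ofNat n a)) = 0 := by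
    rw [← QuadraticMap.polarBilin_apply_apply, map_sum]
    refine sum_eq_zero fun a ha => ?_
    rw [map_sum, LinearMap.sum_apply]
    refine sum_eq_zero fun b hb => ?_
    rw [mem_Ico] at ha hb
    rw [QuadraticMap.polarBilin_apply_apply, QuadraticMap.polar, hp, hp, sub_zero, sub_zero,
      add_comm]
    exact h a b ha.1 ha.2 hb.1 hb.2
  have h1 := QuadraticMap.map_add_add_add_map Q (∑ a ∈ Ico x j, p (Fin.ofNat n a))
    (p (Fin.ofNat n j)) (∑ b ∈ Ico (j + 1) z, p (Fin.ofNat n b))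
  rw [QuadraticMap.polar] at hpolar
  rw [poles, poles, poles, sum_Ico_succ_top hx, sum_eq_sum_Ico_succ_bot (a := j) (by omega),
    ← sum_Ico_consecutive _ hx (show j ≤ z by omega),
    sum_eq_sum_Ico_succ_bot (a := j) (b := z) (by omega), ← add_assoc]
  rw [hp] at h1
  linear_combination h1 + hpolar

lemma biadjointAmplitude_eq (Q : QuadraticForm K V) (p : Fin n → V) (hn : 3 ≤ n) :
    biadjointAmplitude Q p = amputated (poles Q p) 0 (n - 1) := by
  rw [biadjointAmplitude, diagramSum_eq_amputated Q hn]
  refine (amputated_congr (c := 0) (Y := poles Q p) fun z w _ _ hw _ => ?_).trans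
    (by simp)
  rw [zero_add, zero_add, poles, edgeMomentum_eq_sum_Ico (by omega)]
  intro a _
  simp

/-- The off-shell leg is the last one, where the trees are planted, so it enters no edge momentum.
-/
lemma amputatedCurrent_eq (Q : QuadraticForm K V) (p : Fin n → V) (a b : Fin n) (hab : a ≠ b) :
    amputatedCurrent Q p a b =
      amputated (poles Q p) a.val (a.val + arcLength a b) := by
  have h2 : 2 ≤ arcLength a b := by
    have : (b - a).val ≠ 0 := by simpa [sub_eq_zero] using hab.symm
    rw [arcLength]; omega
  rw [amputatedCurrent, diagramSum_eq_amputated Q (by omega)]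
  refine (amputated_congr (c := a.val) (Y := poles Q p) fun z w _ _ hw _ => ?_).trans
    (by simp)
  rw [poles, edgeMomentum_eq_sum_Ico (by omega)
    (f := fun t => p (Fin.ofNat n (a.val + t))), sum_Ico_add (fun t => p (Fin.ofNat n t)) z w a.val,
    add_comm z, add_comm w]
  intro c hc
  obtain ⟨c, rfl⟩ : ∃ d : Fin (arcLength a b), c = d.castSucc :=
    ⟨c.castLT (by omega), (Fin.castSucc_castLT _ _).symm⟩
  rw [Fin.snoc_castSucc, ofNat_val_add]
  rfl

lemma ofNat_mem_cIoo {a b : Fin n} {t : ℕ} (ha : a.val < t) (hb : t < b.val) :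
    Fin.ofNat n t ∈ Set.cIoo a b := by
  have ht : t % n = t := Nat.mod_eq_of_lt (hb.trans b.isLt)
  refine Or.inl ⟨?_, ?_⟩ <;> simpa [Fin.lt_def, ht]

lemma ofNat_mem_cIoo_of_lt {a b : Fin n} {t : ℕ} (hba : b < a) (ha : a.val < t)
    (hb : t < b.val + n) : Fin.ofNat n t ∈ Set.cIoo a b := by
  rw [Fin.lt_def] at hba
  have hb' := b.isLt
  obtain h | h := lt_or_ge t n
  · have ht : t % n = t := Nat.mod_eq_of_lt h
    exact Or.inr (Or.inr ⟨hba, by simpa [Fin.lt_def, ht]⟩)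
  · have ht : t % n = t - n := by
      rw [Nat.mod_eq_sub_mod h, Nat.mod_eq_of_lt (by omega)]
    refine Or.inr (Or.inl ⟨?_, hba⟩)
    simp only [Fin.lt_def, Fin.val_ofNat, ht]
    omega

/-- The smooth 3-split. -/
theorem biadjointAmplitude_split {i j k : Fin n} (hij : i < j) (hjk : j < k)
    (hp : IsMassless Q p) (hsplit : IsSplitKinematics Q p i j k)
    (hs : IsPlanarNonsingular Q p) :
    biadjointAmplitude Q p =
      amputatedCurrent Q p i j * amputatedCurrent Q p j k * amputatedCurrent Q p k i := by
  have h1 : i.val < j.val := hij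
  have h2 : j.val < k.val := hjk
  have hk := k.isLt
  have e1 : i.val + arcLength i j = j.val + 1 := by
    rw [arcLength, Fin.sub_val_of_le hij.le]; omega
  have e2 : j.val + arcLength j k = k.val + 1 := by
    rw [arcLength, Fin.sub_val_of_le hjk.le]; omega
  have e3 : k.val + arcLength k i = i.val + n + 1 := by
    rw [arcLength, Fin.coe_sub_iff_lt.2 (hij.trans hjk)]; omega
  rw [biadjointAmplitude_eq Q p (by omega), amputatedCurrent_eq Q p i j hij.ne,
    amputatedCurrent_eq Q p j k hjk.ne, amputatedCurrent_eq Q p k i (hij.trans hjk).ne', e1, e2, e3]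
  refine (isCyclicPoles hp.conservation hs).amputated_split h1 h2 (by omega) ?_ ?_ ?_
  · intro x z hx hx' hz hz'
    refine poles_add hp.onShell hx'.le hz.le fun a b ha ha' hb hb' => hsplit _ _ (Or.inl ⟨?_, ?_⟩)
    · exact ofNat_mem_cIoo_of_lt (hij.trans hjk) (by omega) (by omega)
    -- Legs after `i + n` have passed the end of the labels and are shifted back by `n`.
    · obtain ⟨c, rfl⟩ := Nat.exists_eq_add_of_le' (show n ≤ b by omega)
      rw [ofNat_add_self]
      exact ofNat_mem_cIoo (by omega) (by omega)
  · intro x z hx hx' hz hz'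
    refine poles_add hp.onShell hx'.le hz.le fun a b ha ha' hb hb' =>
      hsplit _ _ (Or.inr (Or.inl ⟨?_, ?_⟩))
    · exact ofNat_mem_cIoo (by omega) (by omega)
    · exact ofNat_mem_cIoo (by omega) (by omega)
  · intro x z hx hx' hz hz'
    refine poles_add hp.onShell hx'.le hz.le fun a b ha ha' hb hb' =>
      hsplit _ _ (Or.inr (Or.inr ⟨?_, ?_⟩))
    · exact ofNat_mem_cIoo (by omega) (by omega)
    · exact ofNat_mem_cIoo_of_lt (hij.trans hjk) (by omega) (by omega)

end Momenta

/-! ### A nonsingular point of the split kinematics -/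

section Existence

lemma val_lt_of_mem_cIoo {n : ℕ} {a b c : Fin n} (hbc : b < c) (h : a ∈ Set.cIoo b c) :
    b.val < a.val ∧ a.val < c.val := by
  simp only [Set.mem_cIoo, Fin.sbtw_iff, Fin.lt_def] at h hbc
  omega

/-- Basis vectors, except that `i` is replaced by minus the sum of the others. -/
def splitMomenta (K : Type*) [Field K] {n : ℕ} (i : Fin n) (a c : Fin n) : K :=
  (if a = c then 1 else 0) - (if a = i then 1 else 0)

lemma sum_splitMomenta {K : Type*} [Field K] {n : ℕ} (i : Fin n) : ∑ a, splitMomenta K i a = 0 := by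
  ext c
  simp [splitMomenta, Finset.sum_apply]

variable {n : ℕ} [NeZero n]

lemma ofNat_inj_of_lt {x s t : ℕ} (hs : x < s) (hs' : s < x + n) (ht : x < t)
    (ht' : t < x + n) : Fin.ofNat n s = Fin.ofNat n t ↔ s = t := by
  refine ⟨fun h => ?_, fun h => by rw [h]⟩
  have h' : s ≡ t [MOD n] := congrArg Fin.val h
  obtain hst | hst := le_total s t
  · have := (Nat.modEq_iff_dvd' hst).1 h'
    have := Nat.eq_zero_of_dvd_of_lt this (by omega)
    omega
  · have := (Nat.modEq_iff_dvd' hst).1 h'.symm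
    have := Nat.eq_zero_of_dvd_of_lt this (by omega)
    omega

lemma ofNat_val_eq (a : Fin n) : Fin.ofNat n a.val = a := by
  ext; simp

lemma exists_ofNat_of_mem_cIoo {a b c : Fin n} (h : a ∈ Set.cIoo b c) :
    ∃ t, b.val < t ∧ t < c.val + n ∧ Fin.ofNat n t = a := by
  simp only [Set.mem_cIoo, Fin.sbtw_iff, Fin.lt_def] at h
  have := a.isLt
  obtain h' | h' := lt_or_ge b.val a.val
  · exact ⟨a.val, h', by omega, ofNat_val_eq a⟩
  · exact ⟨a.val + n, by omega, by omega, by rw [ofNat_add_self, ofNat_val_eq]⟩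

variable (K : Type*) [Field K]

/-- The quadratic form for which consecutive basis vectors have pairing `1`, up to the pairing of
`i + 1` and `k`, which is adjusted so as to make the remaining momentum null. -/
def splitForm (i k : Fin n) : QuadraticForm K (Fin n → K) :=
  ∑ t ∈ Ico (i.val + 1) (i.val + n - 1),
      QuadraticMap.linMulLin (LinearMap.proj (Fin.ofNat n t)) (LinearMap.proj (Fin.ofNat n (t + 1)))
    - ((n - 2 : ℕ) : K) •
      QuadraticMap.linMulLin (LinearMap.proj (Fin.ofNat n (i.val + 1))) (LinearMap.proj k)

variable {K}

lemma splitForm_apply (i k : Fin n) (x : Fin n → K) :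
    splitForm K i k x =
      ∑ t ∈ Ico (i.val + 1) (i.val + n - 1), x (Fin.ofNat n t) * x (Fin.ofNat n (t + 1)) -
        (n - 2 : ℕ) * (x (Fin.ofNat n (i.val + 1)) * x k) := by
  simp [splitForm]

lemma splitMomenta_ofNat {i : Fin n} {s t : ℕ} (hs : i.val < s) (hs' : s < i.val + n)
    (ht : i.val < t) (ht' : t < i.val + n) :
    splitMomenta K i (Fin.ofNat n s) (Fin.ofNat n t) = if s = t then 1 else 0 := by
  have : Fin.ofNat n s ≠ i := by
    have := i.isLt
    rw [Ne, Fin.ext_iff, Fin.val_ofNat]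
    obtain h | h := lt_or_ge s n
    · rw [Nat.mod_eq_of_lt h]; omega
    · rw [Nat.mod_eq_sub_mod h, Nat.mod_eq_of_lt (by omega)]; omega
  rw [splitMomenta, if_neg this, sub_zero]
  simp only [ofNat_inj_of_lt hs hs' ht ht']

lemma sum_Ico_splitMomenta {i : Fin n} {x y t : ℕ} (hx : i.val < x) (hy : y ≤ i.val + n)
    (ht : i.val < t) (ht' : t < i.val + n) :
    (∑ s ∈ Ico x y, splitMomenta K i (Fin.ofNat n s)) (Fin.ofNat n t) =
      if x ≤ t ∧ t < y then 1 else 0 := by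
  rw [Finset.sum_apply]
  trans ∑ s ∈ Ico x y, if s = t then (1 : K) else 0
  · refine sum_congr rfl fun s hs => ?_
    rw [mem_Ico] at hs
    exact splitMomenta_ofNat (by omega) (by omega) ht ht'
  · rw [sum_ite_eq' (Ico x y) t]
    simp only [mem_Ico]

/-- The momentum of an arc that avoids `i` has its indicator as coordinates away from `i`, so the
form counts neighbouring pairs and corrects when the arc contains both `i + 1` and `k`. -/
lemma poles_splitMomenta {i k : Fin n} (hik : i.val + 1 < k.val) {x y : ℕ} (hx : i.val < x)
    (hxy : x < y) (hy : y ≤ i.val + n) :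
    poles (splitForm K i k) (splitMomenta K i) x y =
      ((y - x - 1 : ℕ) : K) - (n - 2 : ℕ) * if x = i.val + 1 ∧ k.val < y then 1 else 0 := by
  have hk := k.isLt
  have hsum : ∑ t ∈ Ico (i.val + 1) (i.val + n - 1),
      (∑ s ∈ Ico x y, splitMomenta K i (Fin.ofNat n s)) (Fin.ofNat n t) *
        (∑ s ∈ Ico x y, splitMomenta K i (Fin.ofNat n s)) (Fin.ofNat n (t + 1)) =
      ((y - x - 1 : ℕ) : K) := by
    trans ∑ t ∈ Ico (i.val + 1) (i.val + n - 1), if t ∈ Ico x (y - 1) then (1 : K) else 0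
    · refine sum_congr rfl fun t ht => ?_
      rw [mem_Ico] at ht
      rw [sum_Ico_splitMomenta hx hy (by omega) (by omega),
        sum_Ico_splitMomenta hx hy (by omega) (by omega), ite_zero_mul_ite_zero, one_mul]
      refine if_congr ?_ rfl rfl
      rw [mem_Ico]; omega
    · rw [sum_ite_mem, inter_eq_right.2 (Ico_subset_Ico (by omega) (by omega)), sum_const,
        Nat.card_Ico, nsmul_one, Nat.sub_right_comm]
  have hkk := sum_Ico_splitMomenta (K := K) (t := k.val) hx hy (by omega) (by omega)
  rw [ofNat_val_eq] at hkk
  rw [poles, splitForm_apply, hsum, sum_Ico_splitMomenta hx hy (by omega) (by omega), hkk,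
    ite_zero_mul_ite_zero, one_mul]
  congr 2
  refine if_congr ?_ rfl rfl
  omega

variable {i j k : Fin n}

lemma isMassless_splitMomenta (hik : i.val + 1 < k.val) :
    IsMassless (splitForm K i k) (splitMomenta K i) where
  conservation := sum_splitMomenta i
  onShell a := by
    have hk := k.isLt
    have hsingle : ∀ t, i.val < t → t < i.val + n →
        splitForm K i k (splitMomenta K i (Fin.ofNat n t)) = 0 := by
      intro t h1 h2
      have := poles_splitMomenta (K := K) hik h1 (Nat.lt_succ_self t) (by omega)
      rw [poles, Nat.Ico_succ_singleton, sum_singleton, if_neg (by omega)] at this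
      simpa using this
    obtain h | rfl | h := lt_trichotomy a.val i.val |>.imp_right (Or.imp_left Fin.ext)
    · have := hsingle (a.val + n) (by omega) (by omega)
      rwa [ofNat_add_self, ofNat_val_eq] at this
    -- The other `n - 1` legs form `n - 2` neighbouring pairs, which the correction cancels exactly.
    · have h1 := poles_splitMomenta (K := K) hik (Nat.lt_succ_self a.val) (y := a.val + n)
        (by omega) le_rfl
      have h2 := poles_compl (splitForm K a k) (sum_splitMomenta (K := K) a)
        (Nat.le_succ a.val) (by omega)
      rw [h1, if_pos ⟨rfl, by omega⟩, poles, Nat.Ico_succ_singleton, sum_singleton,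
        ofNat_val_eq] at h2
      rw [← h2, show a.val + n - a.val.succ - 1 = n - 2 by omega]
      ring
    · have := hsingle a.val h (by omega)
      rwa [ofNat_val_eq] at this

lemma isSplitKinematics_splitMomenta (hij : i < j) (hjk : j < k) :
    IsSplitKinematics (splitForm K i k) (splitMomenta K i) i j k := by
  rw [Fin.lt_def] at hij hjk
  have hk := k.isLt
  -- Interlacing labels avoid `i` and `k` and are never neighbours, so neither kind of term in the
  -- form sees them.
  have key : ∀ s t, i.val < s → s + 1 < t → t < i.val + n → s ≠ k.val → t ≠ k.val →
      splitForm K i k (splitMomenta K i (Fin.ofNat n s) + splitMomenta K i (Fin.ofNat n t)) =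
        0 := by
    intro s t h1 h2 h3 h4 h5
    have hc : ∀ c, i.val < c → c < i.val + n →
        (splitMomenta K i (Fin.ofNat n s) + splitMomenta K i (Fin.ofNat n t)) (Fin.ofNat n c) =
          if s = c ∨ t = c then 1 else 0 := by
      intro c hc hc'
      rw [Pi.add_apply, splitMomenta_ofNat h1 (by omega) hc hc',
        splitMomenta_ofNat (by omega) h3 hc hc']
      split_ifs <;> first | omega | simp
    have hkk := hc k.val (by omega) (by omega)
    rw [ofNat_val_eq, if_neg (by omega)] at hkk
    rw [splitForm_apply, hkk, mul_zero, mul_zero, sub_zero]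
    refine sum_eq_zero fun c hcm => ?_
    rw [mem_Ico] at hcm
    rw [hc c (by omega) (by omega), hc (c + 1) (by omega) (by omega), ite_zero_mul_ite_zero,
      if_neg (by omega)]
  rintro a b (⟨ha, hb⟩ | ⟨ha, hb⟩ | ⟨ha, hb⟩)
  · obtain ⟨s, hs, hs', rfl⟩ := exists_ofNat_of_mem_cIoo ha
    have := val_lt_of_mem_cIoo hij hb
    rw [mandelstam, add_comm, ← ofNat_val_eq b]
    exact key _ _ (by omega) (by omega) (by omega) (by omega) (by omega)
  · have h1 := val_lt_of_mem_cIoo hij ha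
    have h2 := val_lt_of_mem_cIoo hjk hb
    rw [mandelstam, ← ofNat_val_eq a, ← ofNat_val_eq b]
    exact key _ _ (by omega) (by omega) (by omega) (by omega) (by omega)
  · obtain ⟨s, hs, hs', rfl⟩ := exists_ofNat_of_mem_cIoo hb
    have := val_lt_of_mem_cIoo hjk ha
    rw [mandelstam, ← ofNat_val_eq a]
    exact key _ _ (by omega) (by omega) (by omega) (by omega) (by omega)

lemma isPlanarNonsingular_splitMomenta [CharZero K] (hik : i.val + 1 < k.val) :
    IsPlanarNonsingular (splitForm K i k) (splitMomenta K i) := by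
  have hne : ∀ x y, i.val < x → x + 2 ≤ y → y ≤ i.val + n → y + 2 ≤ x + n →
      poles (splitForm K i k) (splitMomenta K i) x y ≠ 0 := by
    intro x y hx hxy hy hl
    rw [poles_splitMomenta hik hx (by omega) hy, sub_ne_zero]
    -- If the correction enters, the arc starts at `i + 1` and has at most `n - 2` legs, so the
    -- count is at most `n - 3`.
    split_ifs
    · rw [mul_one, Ne, Nat.cast_inj]
      omega
    · rw [mul_zero, Nat.cast_ne_zero]
      omega
  intro a l h2 hl
  have ha := a.isLt
  have hi := i.isLt
  have hsum := sum_splitMomenta (K := K) i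
  rw [arcMomentum_eq_sum_Ico]
  change poles _ _ _ _ ≠ 0
  -- Arcs through `i` are replaced by their complements, the others shifted into the window after
  -- `i`.
  obtain h | h := lt_or_ge i.val a.val
  · obtain h' | h' := le_or_gt (a.val + l) (i.val + n)
    · exact hne _ _ h (by omega) h' (by omega)
    · have e := poles_compl (splitForm K i k) hsum (x := a.val) (y := a.val + l) (by omega)
        (by omega)
      rw [← e, show a.val + l = a.val + l - n + n by omega, poles_add_add]
      exact hne _ _ (by omega) (by omega) (by omega) (by omega)
  · obtain h' | h' := le_or_gt (a.val + l) i.val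
    · rw [← poles_add_add]
      exact hne _ _ (by omega) (by omega) (by omega) (by omega)
    · rw [← poles_compl (splitForm K i k) hsum (by omega) (by omega)]
      exact hne _ _ (by omega) (by omega) (by omega) (by omega)

end Existence

end Biadjoint

theorem mainTheorem1 {K : Type*} [Field K] [CharZero K] {n : ℕ} [NeZero n]
    (i j k : Fin n) (hij : i < j) (hjk : j < k) :
    (∀ {V : Type*} [AddCommGroup V] [Module K V] (Q : QuadraticForm K V) (p : Fin n → V),
      Biadjoint.IsMassless Q p → Biadjoint.IsSplitKinematics Q p i j k →
      Biadjoint.IsPlanarNonsingular Q p →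
      Biadjoint.biadjointAmplitude Q p =
        Biadjoint.amputatedCurrent Q p i j * Biadjoint.amputatedCurrent Q p j k *
          Biadjoint.amputatedCurrent Q p k i) ∧
    (∃ (D : ℕ) (Q : QuadraticForm K (Fin D → K)) (p : Fin n → Fin D → K),
      Biadjoint.IsMassless Q p ∧ Biadjoint.IsSplitKinematics Q p i j k ∧
      Biadjoint.IsPlanarNonsingular Q p) := by
  have hik : i.val + 1 < k.val := by
    rw [Fin.lt_def] at hij hjk
    omega
  exact ⟨fun Q p hp hsplit hs => Biadjoint.biadjointAmplitude_split hij hjk hp hsplit hs,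
    n, Biadjoint.splitForm K i k, Biadjoint.splitMomenta K i,
    Biadjoint.isMassless_splitMomenta hik, Biadjoint.isSplitKinematics_splitMomenta hij hjk,
    Biadjoint.isPlanarNonsingular_splitMomenta hik⟩
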